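/- Let $X$ be a secret with values in $\{1,\dots,n\}$ and prior $p(1)\ge p(2)\ge\dots\ge p(n)>0$, $\sum_x p(x)=1$, and let $1\le k\le n$. A channel is a matrix $p(y|x)\ge 0$ with $\sum_{y\in\mathcal Y}p(y|x)=1$ for every $x$, where $\mathcal Y$ is any discrete set of observables; it is feasible if for every $y$ at most $k$ secrets $x$ satisfy $p(y|x)>0$. Put $p(y)=\sum_x p(x)p(y|x)$ and $p_{X|y}=(p(x)p(y|x)/p(y))_x$ when $p(y)>0$. A generalised entropy is given by a function $\eta:\mathbb R\to\mathbb R$ and a real-valued function $F$ of finite probability vectors that is symmetric (unchanged under reordering the entries) and expansible (unchanged under appending a zero), such that either $F$ is concave on the distributions over $\{1,\dots,n\}$ and $\eta$ is non-decreasing, or $F$ is convex there and $\eta$ is non-increasing (core-concavity); monotonicity of $\eta$ is needed only on the interval spanned by the values of $F$ on those distributions. It defines $$H(q)=\eta(F(q)),\qquad H(X|Y)=\eta\Big(\sum_{y:\,p(y)>0}p(y)\,F(p_{X|y})\Big).$$ Let $$j^*=\min\Big\{1\le j\le k:\ p(j)\le\frac{\sum_{i=j}^n p(i)}{k-j+1}\Big\},\qquad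 \ell=\frac{\sum_{i=j^*}^n p(i)}{k-j^*+1},$$ and let $\pi=(p(1),\dots,p(j^*-1),\ell,\dots,\ell)$, a probability vector of length $k$. For $S\subseteq\{1,\dots,n\}$ let $\mathcal M(S)$ be the set of all $M\subseteq\{1,\dots,n\}$ with $S\subseteq M$ and $|M|=k$. Algorithm 1, on input $p$ and $k$: compute $j^*$; find any numbers $v_M\ge 0$, $M\in\mathcal M(\{1,\dots,j^*-1\})$, with $$\sum_{M\in\mathcal M(\{1,\dots,j^*-1,i\})}v_M=p(i)\qquad (i=j^*,\dots,n);$$ output the channel with one observable $y_M$ for each $k$-element set $M$ and with $p(y_M|i)=v_M/p(i)$ for $i\ge j^*$ and $M\in\mathcal M(\{1,\dots,j^*-1,i\})$, $p(y_M|i)=v_M/\ell$ for $i<j^*$ and $M\in\mathcal M(\{1,\dots,j^*-1\})$, and all other entries zero. Then: A. For every generalised entropy, the sum defining $H(X|Y)$ converges for every channel, and the maximum of $H(X|Y)$ over all feasible channels, with any set of observables, exists and equals $H(\pi)$. B. The linear system in Algorithm 1 is solvable, and for each of its solutions the output of Algorithm 1 is a feasible channel that attains $H(X|Y)=H(\pi)$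 for every generalised entropy at once; its optimality is thus metric-invariant. -/

import Mathlib

/-! Secrets are the elements of `Fin n`; the element `i : Fin n` stands for the secret with
1-based label `i.val + 1`. A (transition) matrix is a function `W : Fin n → Y → ℝ`, where `W x y`
is the conditional probability `p(y | x)` and `Y` is the alphabet of observables. -/

universe u

namespace OptimalChannel

noncomputable section

/-- A prior: a probability distribution on the `n` secrets that gives every secret a positive
probability and is sorted in non-increasing order. -/
structure IsSortedPrior {n : ℕ} (p : Fin n → ℝ) : Prop where
  pos : ∀ x, 0 < p x
  sum_eq_one : ∑ x, p x = 1
  antitone : Antitone p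

section Channels

variable {n : ℕ} {Y : Type u}

/-- `W` is a channel: its entries are non-negative and each row sums to one. The alphabet `Y` is
arbitrary; a row that sums to one has countable support. -/
structure IsChannel (W : Fin n → Y → ℝ) : Prop where
  nonneg : ∀ x y, 0 ≤ W x y
  hasSum_one : ∀ x, HasSum (W x) 1

/-- The pre-image of an observable: the secrets that produce it with non-zero probability. -/
def preIm (W : Fin n → Y → ℝ) (y : Y) : Set (Fin n) := {x | 0 < W x y}

/-- Every pre-image has at most `k` elements. -/
def PreImCap (k : ℕ) (W : Fin n → Y → ℝ) : Prop := ∀ y, (preIm W y).ncard ≤ k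

/-- The probability `p(y)` of the observable `y`. -/
def outProb (p : Fin n → ℝ) (W : Fin n → Y → ℝ) (y : Y) : ℝ := ∑ x, p x * W x y

/-- The posterior distribution `p_{X|y}`, by Bayes' rule (used only when `p(y) > 0`). -/
def posterior (p : Fin n → ℝ) (W : Fin n → Y → ℝ) (y : Y) : Fin n → ℝ :=
  fun x => p x * W x y / outProb p W y

end Channels

/-- A family `F` of functions of finite probability vectors (`F m` is applied to vectors of length
`m`) and a function `η` define a generalised entropy for `n` secrets: `F` is symmetric and
expansible, and the pair is core-concave on the distributions over the `n` secrets. Monotonicity of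
`η` is required only on the interval spanned by the values of `F` on these distributions, so that
`η` may be, for example, a logarithm. -/
structure IsGenEntropy (n : ℕ) (F : (m : ℕ) → (Fin m → ℝ) → ℝ) (η : ℝ → ℝ) : Prop where
  symmetric : ∀ (m : ℕ) (q : Fin m → ℝ), q ∈ stdSimplex ℝ (Fin m) →
    ∀ σ : Equiv.Perm (Fin m), F m (q ∘ σ) = F m q
  expansible : ∀ (m : ℕ) (q : Fin m → ℝ), q ∈ stdSimplex ℝ (Fin m) →
    F (m + 1) (Fin.snoc (α := fun _ => ℝ) q 0) = F m q
  core_concave :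
    (MonotoneOn η (convexHull ℝ (F n '' stdSimplex ℝ (Fin n))) ∧
      ConcaveOn ℝ (stdSimplex ℝ (Fin n)) (F n)) ∨
    (AntitoneOn η (convexHull ℝ (F n '' stdSimplex ℝ (Fin n))) ∧
      ConvexOn ℝ (stdSimplex ℝ (Fin n)) (F n))

/-- The (unconditional) entropy `H(q) = η(F(q))` of a probability vector `q`. -/
def entropy (F : (m : ℕ) → (Fin m → ℝ) → ℝ) (η : ℝ → ℝ) {m : ℕ} (q : Fin m → ℝ) : ℝ :=
  η (F m q)

/-- The posterior entropy `H(X|Y) = η(∑ p(y) F(p_{X|y}))`. Observables with `p(y) = 0` contribute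
zero to the sum. -/
def posteriorEntropy (F : (m : ℕ) → (Fin m → ℝ) → ℝ) (η : ℝ → ℝ) {n : ℕ} {Y : Type u}
    (p : Fin n → ℝ) (W : Fin n → Y → ℝ) : ℝ :=
  η (∑' y, outProb p W y * F n (posterior p W y))

section Algorithm

variable {n : ℕ}

/-- `p(j) + p(j+1) + ⋯ + p(n)`, for a 1-based index `j`. -/
def tailSum (p : Fin n → ℝ) (j : ℕ) : ℝ := ∑ i with j ≤ i.val + 1, p i

/-- The 1-based index `j* = min {j : 1 ≤ j ≤ k, p(j) ≤ (p(j) + ⋯ + p(n)) / (k - j + 1)}`. -/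
def jStar (p : Fin n → ℝ) (k : ℕ) : ℕ :=
  sInf {j : ℕ | j ≤ k ∧ ∃ i : Fin n, i.val + 1 = j ∧ p i ≤ tailSum p j / ((k : ℝ) - j + 1)}

/-- The common value `(p(j*) + ⋯ + p(n)) / (k - j* + 1)`. -/
def level (p : Fin n → ℝ) (k : ℕ) : ℝ :=
  tailSum p (jStar p k) / ((k : ℝ) - jStar p k + 1)

/-- The vector `π` of length `k`: the entries with 1-based index less than `j*` are those of the
prior, the others are all equal to `(p(j*) + ⋯ + p(n)) / (k - j* + 1)`. -/
def piVec (p : Fin n → ℝ) (k : ℕ) (hk : k ≤ n) : Fin k → ℝ :=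
  fun l => if l.val + 1 < jStar p k then p (Fin.castLE hk l) else level p k

/-- The set `{1, …, j* - 1}` of giants. -/
def giants (p : Fin n → ℝ) (k : ℕ) : Finset (Fin n) := {i | i.val + 1 < jStar p k}

/-- `𝓜(S)`: the `k`-element sets of secrets that include `S`. -/
def superSets (k : ℕ) (S : Finset (Fin n)) : Finset (Finset (Fin n)) :=
  {M | S ⊆ M ∧ M.card = k}

/-- `v` solves the linear feasibility system of the algorithm. -/
structure SolvesSystem (p : Fin n → ℝ) (k : ℕ) (v : Finset (Fin n) → ℝ) : Prop where
  nonneg : ∀ M ∈ superSets k (giants p k), 0 ≤ v M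
  eq : ∀ i : Fin n, jStar p k ≤ i.val + 1 →
    ∑ M ∈ superSets k (insert i (giants p k)), v M = p i

/-- The matrix that the algorithm assembles from a solution `v` of the linear system. Its
observables `y_M` are indexed by the `k`-element sets `M` of secrets. -/
def algMatrix (p : Fin n → ℝ) (k : ℕ) (v : Finset (Fin n) → ℝ) :
    Fin n → {M : Finset (Fin n) // M.card = k} → ℝ :=
  fun i M =>
    if jStar p k ≤ i.val + 1 then
      if M.val ∈ superSets k (insert i (giants p k)) then v M.val / p i else 0
    else
      if M.val ∈ superSets k (giants p k) then
        v M.val * ((k : ℝ) - jStar p k + 1) / tailSum p (jStar p k)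
      else 0

/-- `W` is a possible output of the algorithm on input `p`, `k`: compute `j*`, solve the linear
system, and assemble the matrix from the solution found. -/
def IsAlgOutput (p : Fin n → ℝ) (k : ℕ)
    (W : Fin n → {M : Finset (Fin n) // M.card = k} → ℝ) : Prop :=
  ∃ v : Finset (Fin n) → ℝ, SolvesSystem p k v ∧ W = algMatrix p k v

end Algorithm

end

end OptimalChannel

/-! Upper bound. By symmetry and expansibility `F` restricts to a symmetric concave function on
distributions of length `k`. The vector `π` has positive entries, so there is a supergradient `g`
there. Averaged over the permutations that fix `π`, it becomes constant on ties of `π` and ordered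
oppositely to `π` (`exists_supergradient_of_symmetric`). Hence `g` takes its largest value `c` on
the plateau of `π`. Extend `g` by `c` to a weight `G` on all secrets. A posterior of a feasible
channel lives on a `k`-element set, which can be moved onto the first `k` positions with its giants
fixed. Other secrets carry the largest weight `c`, so the move cannot increase the linear term.
Posteriors average to the prior, and `p` and `π` have the same mean weight because they agree on the
giants and `G = c` elsewhere. So the mean of `F` is at most `F π` (`tsum_outProb_mul_le`); the
convex case follows by negating `F`.

Attainment. The vector that is `1` on the giants and `p i / ℓ` elsewhere lies in the hypersimplex,
hence is a mixture of indicators of `k`-element sets; scaled by `ℓ`, the weights solve the linear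
system (`exists_solvesSystem`). For any solution, each posterior is `π` up to zeros and order
(`exists_posterior_algMatrix_eq`), so concavity plays no role in the equality. -/

namespace OptimalChannel

/-! ### Supergradients of symmetric concave functions on the simplex. -/

section Supergradient

variable {ι : Type*} [Fintype ι]

/-- The positively homogeneous extension of a concave function on the standard simplex is concave on
the open positive orthant. -/
lemma concaveOn_homogenization [Nonempty ι] {f : (ι → ℝ) → ℝ}
    (hf : ConcaveOn ℝ (stdSimplex ℝ ι) f) :
    ConcaveOn ℝ {x : ι → ℝ | ∀ i, 0 < x i} fun x => (∑ i, x i) * f ((∑ i, x i)⁻¹ • x) := by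
  refine ⟨?_, ?_⟩
  · intro x hx y hy a b ha hb hab i
    rcases ha.eq_or_lt with rfl | ha
    · simpa [show b = 1 by linarith] using hy i
    · have := mul_pos ha (hx i)
      have := mul_nonneg hb (hy i).le
      simp only [Pi.add_apply, Pi.smul_apply, smul_eq_mul]
      linarith
  · intro x hx y hy a b ha hb hab
    have hpos : ∀ z : ι → ℝ, (∀ i, 0 < z i) → 0 < ∑ i, z i := fun z hz =>
      Finset.sum_pos (fun i _ => hz i) Finset.univ_nonempty
    have hmem : ∀ z : ι → ℝ, (∀ i, 0 < z i) → (∑ i, z i)⁻¹ • z ∈ stdSimplex ℝ ι := fun z hz =>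
      ⟨fun i => mul_nonneg (inv_nonneg.2 (hpos z hz).le) (hz i).le, by
        simp only [Pi.smul_apply, smul_eq_mul, ← Finset.mul_sum]
        exact inv_mul_cancel₀ (hpos z hz).ne'⟩
    have hX := hpos x hx
    have hY := hpos y hy
    have hS : ∑ i, (a • x + b • y) i = a * ∑ i, x i + b * ∑ i, y i := by
      simp [Finset.sum_add_distrib, Finset.mul_sum]
    have hSpos : 0 < a * ∑ i, x i + b * ∑ i, y i := by
      rcases ha.eq_or_lt with rfl | ha
      · simpa [show b = 1 by linarith] using hY
      · have := mul_pos ha hX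
        have := mul_nonneg hb hY.le
        linarith
    simp only [hS]
    generalize hsX : ∑ i, x i = X at *
    generalize hsY : ∑ i, y i = Y at *
    have ha' : 0 ≤ a * X / (a * X + b * Y) := by positivity
    have hb' : 0 ≤ b * Y / (a * X + b * Y) := by positivity
    -- Normalising `a • x + b • y` mixes the normalised points in proportion to their masses.
    have h := hf.2 (hmem x hx) (hmem y hy) ha' hb' (by field_simp)
    have hvec : (a * X / (a * X + b * Y)) • (∑ i, x i)⁻¹ • x
        + (b * Y / (a * X + b * Y)) • (∑ i, y i)⁻¹ • y
        = (a * X + b * Y)⁻¹ • (a • x + b • y) := by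
      ext i
      simp only [hsX, hsY, Pi.add_apply, Pi.smul_apply, smul_eq_mul]
      field_simp
    rw [hvec, hsX, hsY] at h
    have h2 := mul_le_mul_of_nonneg_left h hSpos.le
    simp only [smul_eq_mul] at h2 ⊢
    refine le_trans (le_of_eq ?_) h2
    field_simp

/-- A concave function on the standard simplex has a supergradient at every point with positive
entries. -/
lemma exists_supergradient {f : (ι → ℝ) → ℝ} (hf : ConcaveOn ℝ (stdSimplex ℝ ι) f)
    {π : ι → ℝ} (hπ : π ∈ stdSimplex ℝ ι) (hpos : ∀ i, 0 < π i) :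
    ∃ g : ι → ℝ, ∀ q ∈ stdSimplex ℝ ι, f q ≤ f π + ∑ i, g i * (q i - π i) := by
  classical
  have hne : Nonempty ι := by
    by_contra h
    rw [not_nonempty_iff] at h
    simpa using hπ.2
  -- The simplex has empty interior; the homogeneous extension lives on an open set, so it is
  -- continuous there and its strict hypograph is open.
  set G : (ι → ℝ) → ℝ := fun x => (∑ i, x i) * f ((∑ i, x i)⁻¹ • x) with hG
  have hGs : ∀ q ∈ stdSimplex ℝ ι, G q = f q := fun q hq => by simp [hG, hq.2]
  set U : Set (ι → ℝ) := {x | ∀ i, 0 < x i} with hU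
  have hUo : IsOpen U := by
    simp only [hU, Set.ofPred_forall]
    exact isOpen_iInter_of_finite fun i => isOpen_lt continuous_const (continuous_apply i)
  have hGc : ConcaveOn ℝ U G := concaveOn_homogenization hf
  have hcont : ContinuousOn G U := hGc.continuousOn hUo
  have hopen : IsOpen {z : (ι → ℝ) × ℝ | z.1 ∈ U ∧ z.2 < G z.1} := by
    have hc : ContinuousOn (fun z : (ι → ℝ) × ℝ => G z.1 - z.2) (Prod.fst ⁻¹' U) :=
      (hcont.comp continuousOn_fst fun z hz => hz).sub continuousOn_snd
    have := hc.isOpen_inter_preimage (hUo.preimage continuous_fst) (isOpen_Ioi (a := (0 : ℝ)))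
    convert this using 1
    ext z
    simp
  obtain ⟨L, hL⟩ := geometric_hahn_banach_open_point (x := (π, G π))
    hGc.convex_strict_hypograph hopen (by simp)
  have hsplit : ∀ x t, L (x, t) = L (x, 0) + t * L (0, 1) := fun x t => by
    rw [show ((x, t) : (ι → ℝ) × ℝ) = (x, 0) + t • (0, 1) by simp, map_add, map_smul, smul_eq_mul]
  -- The separating hyperplane is not vertical: test a point just below the graph over `π`.
  have hb : 0 < L (0, 1) := by
    have := hL (π, G π - 1) ⟨hpos, by simp⟩
    rw [hsplit, hsplit π (G π)] at this
    linarith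
  set b := L (0, 1) with hbdef
  have hlin : ∀ x : ι → ℝ, L (x, 0) = ∑ i, x i * L (Pi.single i 1, 0) := fun x => by
    have h := (L.toLinearMap.comp (LinearMap.inl ℝ (ι → ℝ) ℝ)).pi_apply_eq_sum_univ x
    refine h.trans (Finset.sum_congr rfl fun i _ => ?_)
    have hi : (fun j => if i = j then (1 : ℝ) else 0) = Pi.single i 1 := by
      ext j
      simp [Pi.single_apply, eq_comm]
    simp [hi]
  have hint : ∀ q ∈ stdSimplex ℝ ι, (∀ i, 0 < q i) →
      f q ≤ f π + (L (π, 0) - L (q, 0)) / b := by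
    intro q hq hq0
    refine le_of_forall_lt fun t ht => ?_
    have := hL (q, t) ⟨hq0, by simpa [hGs q hq] using ht⟩
    rw [hsplit, hsplit π, hGs π hπ] at this
    rw [← sub_lt_iff_lt_add', lt_div_iff₀ hb]
    linarith
  refine ⟨fun i => -L (Pi.single i 1, 0) / b, fun q hq => ?_⟩
  have hsum : ∑ i, -L (Pi.single i 1, 0) / b * (q i - π i) = (L (π, 0) - L (q, 0)) / b := by
    rw [hlin π, hlin q, ← Finset.sum_sub_distrib, Finset.sum_div]
    exact Finset.sum_congr rfl fun i _ => by ring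
  rw [hsum]
  -- A boundary point `q` is reached through its midpoint with `π`, which has positive entries;
  -- concavity transfers the bound back to `q`.
  have hm : (1 / 2 : ℝ) • π + (1 / 2 : ℝ) • q ∈ stdSimplex ℝ ι :=
    convex_stdSimplex ℝ ι hπ hq (by norm_num) (by norm_num) (by norm_num)
  have h1 := hint _ hm fun i => by
    have := hpos i
    have := hq.1 i
    simp only [Pi.add_apply, Pi.smul_apply, smul_eq_mul]
    linarith
  have h2 := hf.2 hπ hq (show (0 : ℝ) ≤ 1 / 2 by norm_num) (show (0 : ℝ) ≤ 1 / 2 by norm_num)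
    (by norm_num)
  have h3 : L ((1 / 2 : ℝ) • π + (1 / 2 : ℝ) • q, 0) = 1 / 2 * L (π, 0) + 1 / 2 * L (q, 0) := by
    rw [hlin, hlin π, hlin q, Finset.mul_sum, Finset.mul_sum, ← Finset.sum_add_distrib]
    exact Finset.sum_congr rfl fun i _ => by simp; ring
  have h4 : (L (π, 0) - L ((1 / 2 : ℝ) • π + (1 / 2 : ℝ) • q, 0)) / b
      = 1 / 2 * ((L (π, 0) - L (q, 0)) / b) := by
    rw [h3]; ring
  rw [h4] at h1
  simp only [smul_eq_mul] at h2
  linarith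

lemma comp_perm_mem_stdSimplex {q : ι → ℝ} (hq : q ∈ stdSimplex ℝ ι) (σ : Equiv.Perm ι) :
    q ∘ σ ∈ stdSimplex ℝ ι :=
  ⟨fun i => hq.1 (σ i), (Equiv.sum_comp σ q).trans hq.2⟩

/-- A symmetric concave function on the standard simplex has, at every point with positive entries,
a supergradient that is ordered oppositely to that point and constant on its ties. -/
lemma exists_supergradient_of_symmetric {f : (ι → ℝ) → ℝ} (hf : ConcaveOn ℝ (stdSimplex ℝ ι) f)
    (hsymm : ∀ q ∈ stdSimplex ℝ ι, ∀ σ : Equiv.Perm ι, f (q ∘ σ) = f q)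
    {π : ι → ℝ} (hπ : π ∈ stdSimplex ℝ ι) (hpos : ∀ i, 0 < π i) :
    ∃ g : ι → ℝ, (∀ q ∈ stdSimplex ℝ ι, f q ≤ f π + ∑ i, g i * (q i - π i)) ∧
      (∀ i j, π i = π j → g i = g j) ∧ ∀ i j, π j < π i → g i ≤ g j := by
  classical
  obtain ⟨g₀, hg₀⟩ := exists_supergradient hf hπ hpos
  -- The stabiliser of `π`; averaging over it keeps the supergradient inequality, as `f` is
  -- symmetric.
  set P : Finset (Equiv.Perm ι) := {σ | π ∘ σ = π} with hP
  have hPc : (0 : ℝ) < P.card := by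
    exact_mod_cast Finset.card_pos.2 ⟨1, by simp [hP]⟩
  set g : ι → ℝ := fun i => (∑ σ ∈ P, g₀ (σ i)) / P.card with hg
  have hsuper : ∀ q ∈ stdSimplex ℝ ι, f q ≤ f π + ∑ i, g i * (q i - π i) := by
    intro q hq
    have h1 : ∀ σ ∈ P, f q ≤ f π + ∑ i, g₀ (σ i) * (q i - π i) := by
      intro σ hσ
      have hσ' : π ∘ σ = π := by simpa [hP] using hσ
      have h := hg₀ _ (comp_perm_mem_stdSimplex hq σ⁻¹)
      rw [hsymm q hq] at h
      refine h.trans_eq ?_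
      rw [← Equiv.sum_comp σ]
      congr 1
      refine Finset.sum_congr rfl fun i _ => ?_
      have := congrFun hσ' i
      simp only [Function.comp_apply] at this
      simp [this]
    have h2 := Finset.sum_le_sum h1
    rw [Finset.sum_const, Finset.sum_add_distrib, Finset.sum_const, nsmul_eq_mul, nsmul_eq_mul,
      Finset.sum_comm] at h2
    have h3 : ∑ i, g i * (q i - π i) = (∑ i, ∑ σ ∈ P, g₀ (σ i) * (q i - π i)) / P.card := by
      rw [Finset.sum_div]
      refine Finset.sum_congr rfl fun i _ => ?_
      rw [← Finset.sum_mul]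
      ring
    rw [h3, ← sub_le_iff_le_add', le_div_iff₀ hPc]
    linarith
  have hcomp : ∀ i j, π ∘ Equiv.swap i j ∈ stdSimplex ℝ ι := fun i j =>
    comp_perm_mem_stdSimplex hπ _
  refine ⟨g, hsuper, fun i j hij => ?_, fun i j hij => ?_⟩
  · have hs : π ∘ Equiv.swap i j = π := by
      ext x
      simp only [Function.comp_apply, Equiv.swap_apply_def]
      split_ifs with h h
      · rw [h, hij]
      · rw [h, hij]
      · rfl
    simp only [hg]
    congr 1
    refine Finset.sum_bij' (fun σ _ => σ * Equiv.swap i j) (fun σ _ => σ * Equiv.swap i j)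
      ?_ ?_ ?_ ?_ ?_
    · intro σ hσ
      have hσ' : π ∘ σ = π := by simpa [hP] using hσ
      simp [hP, Equiv.Perm.coe_mul, ← Function.comp_assoc, hσ', hs]
    · intro σ hσ
      have hσ' : π ∘ σ = π := by simpa [hP] using hσ
      simp [hP, Equiv.Perm.coe_mul, ← Function.comp_assoc, hσ', hs]
    · intro σ _
      simp [mul_assoc]
    · intro σ _
      simp [mul_assoc]
    · intro σ _
      simp
  · have hne : i ≠ j := by
      rintro rfl
      exact lt_irrefl _ hij
    -- Since `f` takes the same value at the swapped point, the inequality reads `0 ≤ (g i - g j) *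
    -- (π j - π i)`.
    have h := hsuper _ (hcomp i j)
    rw [hsymm π hπ] at h
    have hsum : ∑ x, g x * ((π ∘ Equiv.swap i j) x - π x) = (g i - g j) * (π j - π i) := by
      rw [← Finset.sum_subset (Finset.subset_univ {i, j})]
      · rw [Finset.sum_pair hne]
        simp
        ring
      · intro x _ hx
        simp only [Finset.mem_insert, Finset.mem_singleton, not_or] at hx
        simp [Equiv.swap_apply_of_ne_of_ne hx.1 hx.2]
    rw [hsum] at h
    by_contra hlt
    push Not at hlt
    have := mul_neg_of_pos_of_neg (sub_pos.2 hlt) (sub_neg.2 hij)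
    linarith

end Supergradient

/-! ### Vertices of the hypersimplex. -/

section Hypersimplex

variable {ι : Type*} [Fintype ι] [DecidableEq ι]

/-- A point of the hypersimplex is a mixture of indicator vectors of `k`-element sets. -/
lemma exists_weights_of_hypersimplex (k : ℕ) (x : ι → ℝ) (h0 : ∀ i, 0 ≤ x i) (h1 : ∀ i, x i ≤ 1)
    (hsum : ∑ i, x i = k) :
    ∃ v : Finset ι → ℝ, (∀ M, 0 ≤ v M) ∧ (∀ M, M.card ≠ k → v M = 0) ∧ (∑ M, v M = 1) ∧
      ∀ i, ∑ M with i ∈ M, v M = x i := by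
  -- Induction on the number of fractional coordinates.
  induction hN : (Finset.univ.filter fun i => x i ≠ 0 ∧ x i ≠ 1).card using
    Nat.strong_induction_on generalizing x with
  | _ N ih =>
  subst hN
  by_cases hall : ∀ i, x i = 0 ∨ x i = 1
  · set M₀ : Finset ι := {i | x i = 1} with hM₀
    have hx : ∀ i, x i = if i ∈ M₀ then 1 else 0 := fun i => by
      rcases hall i with h | h <;> simp [hM₀, h]
    have hcard : M₀.card = k := by
      have : (M₀.card : ℝ) = k := by rw [← hsum]; simp [hx]
      exact_mod_cast this
    refine ⟨fun M => if M = M₀ then 1 else 0, fun M => by dsimp only; split_ifs <;> norm_num,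
      fun M hM => if_neg (by rintro rfl; exact hM hcard), by simp, fun i => ?_⟩
    rw [hx i, Finset.sum_ite_eq']
    simp
  push Not at hall
  obtain ⟨i, hi0, hi1⟩ := hall
  -- With a single fractional coordinate the sum could not be the integer `k`.
  obtain ⟨j, hji, hj0, hj1⟩ : ∃ j, j ≠ i ∧ x j ≠ 0 ∧ x j ≠ 1 := by
    by_contra hcon
    push Not at hcon
    have hint : ∀ j, j ≠ i → x j = if x j = 1 then 1 else 0 := fun j hj => by
      by_cases h : x j = 0
      · simp [h]
      · simp [hcon j hj h]
    have h2 : x i = (((k : ℤ) - ((Finset.univ.erase i).filter fun j => x j = 1).card : ℤ) : ℝ) := by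
      rw [← Finset.add_sum_erase _ _ (Finset.mem_univ i),
        Finset.sum_congr rfl fun j hj => hint j (Finset.ne_of_mem_erase hj)] at hsum
      push_cast
      rw [← hsum]
      simp
    have ha : (0 : ℝ) < x i := lt_of_le_of_ne (h0 i) (Ne.symm hi0)
    have hb : x i < 1 := lt_of_le_of_ne (h1 i) hi1
    rw [h2] at ha hb
    norm_cast at ha hb
    omega
  have step : ∀ a b : ι, a ≠ b → 0 < x a → x a < 1 → 0 < x b → x b < 1 →
      ∃ t : ℝ, 0 < t ∧ ∃ v : Finset ι → ℝ, (∀ M, 0 ≤ v M) ∧ (∀ M, M.card ≠ k → v M = 0) ∧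
        (∑ M, v M = 1) ∧
        ∀ i, ∑ M with i ∈ M, v M = x i + t * ((if i = a then 1 else 0) - if i = b then 1 else 0) := by
    intro a b hab ha0 ha1 hb0 hb1
    -- Shift mass from `b` to `a` until one of the two becomes integral.
    set t := min (1 - x a) (x b) with ht
    have ht0 : 0 < t := lt_min (by linarith) hb0
    have hta : t ≤ 1 - x a := min_le_left _ _
    have htb : t ≤ x b := min_le_right _ _
    set y : ι → ℝ := fun i => x i + t * ((if i = a then 1 else 0) - if i = b then 1 else 0) with hy
    have hya : y a = x a + t := by simp [hy, hab]
    have hyb : y b = x b - t := by simp [hy, hab.symm]; ring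
    have hyo : ∀ i, i ≠ a → i ≠ b → y i = x i := fun i h h' => by simp [hy, h, h']
    refine ⟨t, ht0, ih _ ?_ y (fun i => ?_) (fun i => ?_) ?_ rfl⟩
    · refine Finset.card_lt_card (Finset.ssubset_iff_subset_ne.2 ⟨fun i hi => ?_, fun heq => ?_⟩)
      · by_cases hia : i = a
        · subst hia; simp [ha0.ne', ha1.ne]
        by_cases hib : i = b
        · subst hib; simp [hb0.ne', hb1.ne]
        simpa [hyo i hia hib] using hi
      · have h3 : a ∈ (Finset.univ.filter fun i => y i ≠ 0 ∧ y i ≠ 1) := by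
          rw [heq]; simp [ha0.ne', ha1.ne]
        have h4 : b ∈ (Finset.univ.filter fun i => y i ≠ 0 ∧ y i ≠ 1) := by
          rw [heq]; simp [hb0.ne', hb1.ne]
        simp only [Finset.mem_filter, Finset.mem_univ, true_and, hya, hyb] at h3 h4
        rcases min_choice (1 - x a) (x b) with h | h
        · exact h3.2 (by rw [ht, h]; ring)
        · exact h4.1 (by rw [ht, h]; ring)
    · by_cases hia : i = a
      · subst hia; rw [hya]; linarith
      by_cases hib : i = b
      · subst hib; rw [hyb]; linarith
      rw [hyo i hia hib]; exact h0 i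
    · by_cases hia : i = a
      · subst hia; rw [hya]; linarith
      by_cases hib : i = b
      · subst hib; rw [hyb]; linarith
      rw [hyo i hia hib]; exact h1 i
    · simp [hy, Finset.sum_add_distrib, ← Finset.mul_sum, hsum]
  have hi0' := lt_of_le_of_ne (h0 i) (Ne.symm hi0)
  have hj0' := lt_of_le_of_ne (h0 j) (Ne.symm hj0)
  have hi1' := lt_of_le_of_ne (h1 i) hi1
  have hj1' := lt_of_le_of_ne (h1 j) hj1
  obtain ⟨s, hs, v, hv0, hvk, hv1, hv⟩ := step i j hji.symm hi0' hi1' hj0' hj1'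
  obtain ⟨t, ht, w, hw0, hwk, hw1, hw⟩ := step j i hji hj0' hj1' hi0' hi1'
  -- These weights cancel the two opposite shifts, of sizes `s` and `t`.
  refine ⟨fun M => t / (s + t) * v M + s / (s + t) * w M, fun M => ?_, fun M hM => ?_, ?_,
    fun l => ?_⟩
  · have := hv0 M
    have := hw0 M
    positivity
  · simp [hvk M hM, hwk M hM]
  · rw [Finset.sum_add_distrib, ← Finset.mul_sum, ← Finset.mul_sum, hv1, hw1]
    field_simp
    ring
  · rw [Finset.sum_add_distrib, ← Finset.mul_sum, ← Finset.mul_sum, hv, hw]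
    field_simp
    ring

end Hypersimplex

/-! ### The threshold `j*`, the level and the vector `π`. -/

section WaterLevel

variable {n k : ℕ} {p : Fin n → ℝ}

/-- The infimum is attained because `j = k` always qualifies: the tail sum contains `p(k)`. -/
lemma jStar_mem (hk1 : 1 ≤ k) (hkn : k ≤ n) (hp : IsSortedPrior p) :
    jStar p k ≤ k ∧
      ∃ i : Fin n, i.val + 1 = jStar p k ∧ p i ≤ tailSum p (jStar p k) / ((k : ℝ) - jStar p k + 1) :=
  Nat.sInf_mem (s := {j : ℕ | j ≤ k ∧ ∃ i : Fin n, i.val + 1 = j ∧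
    p i ≤ tailSum p j / ((k : ℝ) - j + 1)}) ⟨k, le_rfl, ⟨k - 1, by omega⟩, by simp; omega, by
      simp only [sub_self, zero_add, div_one, tailSum]
      refine Finset.single_le_sum (f := p) (fun i _ => (hp.pos i).le) ?_
      simp; omega⟩

lemma one_le_jStar (hk1 : 1 ≤ k) (hkn : k ≤ n) (hp : IsSortedPrior p) : 1 ≤ jStar p k := by
  obtain ⟨-, i, hi, -⟩ := jStar_mem hk1 hkn hp
  omega

lemma gap_pos (hk1 : 1 ≤ k) (hkn : k ≤ n) (hp : IsSortedPrior p) :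
    0 < (k : ℝ) - jStar p k + 1 := by
  have : (jStar p k : ℝ) ≤ k := by exact_mod_cast (jStar_mem hk1 hkn hp).1
  linarith

lemma level_mul_gap (hk1 : 1 ≤ k) (hkn : k ≤ n) (hp : IsSortedPrior p) :
    level p k * ((k : ℝ) - jStar p k + 1) = tailSum p (jStar p k) :=
  div_mul_cancel₀ _ (gap_pos hk1 hkn hp).ne'

lemma le_level (hk1 : 1 ≤ k) (hkn : k ≤ n) (hp : IsSortedPrior p) {i : Fin n}
    (hi : jStar p k ≤ i.val + 1) : p i ≤ level p k := by
  obtain ⟨-, a, ha, hle⟩ := jStar_mem hk1 hkn hp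
  exact (hp.antitone (Fin.le_def.2 (by omega))).trans hle

lemma level_pos (hk1 : 1 ≤ k) (hkn : k ≤ n) (hp : IsSortedPrior p) : 0 < level p k := by
  obtain ⟨-, a, ha, hle⟩ := jStar_mem hk1 hkn hp
  exact (hp.pos a).trans_le hle

lemma tailSum_eq_add (m : Fin n) : tailSum p (m.val + 1) = p m + tailSum p (m.val + 1 + 1) := by
  have : (Finset.univ.filter fun i : Fin n => m.val + 1 ≤ i.val + 1)
      = insert m (Finset.univ.filter fun i : Fin n => m.val + 1 + 1 ≤ i.val + 1) := by
    ext i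
    simp only [Finset.mem_filter, Finset.mem_univ, true_and, Finset.mem_insert, Fin.ext_iff]
    omega
  rw [tailSum, this, Finset.sum_insert (by simp), tailSum]

/-- By minimality `j* - 1` fails the test. An entry above the average of its tail over the remaining
slots also exceeds the average left once the entry and one slot are removed, which is the level. -/
lemma level_lt (hk1 : 1 ≤ k) (hkn : k ≤ n) (hp : IsSortedPrior p) {i : Fin n}
    (hi : i.val + 1 < jStar p k) : level p k < p i := by
  have hjk := (jStar_mem hk1 hkn hp).1
  obtain ⟨a, ha⟩ : ∃ a : Fin n, a.val + 1 + 1 = jStar p k :=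
    ⟨⟨jStar p k - 2, by omega⟩, by simp; omega⟩
  refine lt_of_lt_of_le ?_ (hp.antitone (Fin.le_def.2 (by omega) : i ≤ a))
  have hnot := Nat.notMem_of_lt_sInf (show a.val + 1 < sInf {j : ℕ | j ≤ k ∧ ∃ i : Fin n,
    i.val + 1 = j ∧ p i ≤ tailSum p j / ((k : ℝ) - j + 1)} by
      change _ < jStar p k; omega)
  simp only [Set.mem_ofPred_eq, not_and, not_exists, not_le] at hnot
  have h := hnot (by omega) a rfl
  have hgap := gap_pos hk1 hkn hp
  have hcast : (jStar p k : ℝ) = (a.val + 1 : ℕ) + 1 := by rw [← ha]; push_cast; ring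
  rw [div_lt_iff₀ (by rw [hcast] at hgap; linarith), tailSum_eq_add, ha] at h
  rw [level, div_lt_iff₀ hgap]
  rw [hcast] at hgap ⊢
  linarith

lemma mem_giants {i : Fin n} : i ∈ giants p k ↔ i.val + 1 < jStar p k := by simp [giants]

lemma card_giants (hk1 : 1 ≤ k) (hkn : k ≤ n) (hp : IsSortedPrior p) :
    (giants p k).card + 1 = jStar p k := by
  have h1 := one_le_jStar hk1 hkn hp
  have hjk := (jStar_mem hk1 hkn hp).1
  have : giants p k = Finset.univ.filter fun i : Fin n => i.val < jStar p k - 1 := by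
    ext i
    simp [giants]
    omega
  rw [this, Fin.card_filter_val_lt]
  omega

lemma sum_giants_add_tailSum (hp : IsSortedPrior p) :
    ∑ i ∈ giants p k, p i + tailSum p (jStar p k) = 1 := by
  rw [← hp.sum_eq_one, ← Finset.sum_filter_add_sum_filter_not Finset.univ
    fun i : Fin n => i.val + 1 < jStar p k]
  simp [giants, tailSum]

/-- A vector of length `k`, extended by zeros to length `n`. -/
def zeroPad (n : ℕ) {k : ℕ} (q : Fin k → ℝ) : Fin n → ℝ :=
  fun i => if h : i.val < k then q ⟨i, h⟩ else 0

lemma sum_castLE (hkn : k ≤ n) (f : Fin n → ℝ) (hf : ∀ i : Fin n, k ≤ i.val → f i = 0) :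
    ∑ l : Fin k, f (Fin.castLE hkn l) = ∑ i, f i :=
  Fintype.sum_of_injective _ (Fin.castLE_injective hkn) _ _ (fun i hi => hf i (by
    by_contra h
    exact hi ⟨⟨i, by omega⟩, by ext; simp⟩)) fun _ => rfl

lemma zeroPad_castLE (hkn : k ≤ n) (q : Fin k → ℝ) (l : Fin k) :
    zeroPad n q (Fin.castLE hkn l) = q l := by
  simp [zeroPad]

lemma sum_zeroPad (hkn : k ≤ n) (q : Fin k → ℝ) : ∑ i, zeroPad n q i = ∑ l, q l := by
  rw [← sum_castLE hkn]
  · simp [zeroPad_castLE]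
  · intro i hi
    simp [zeroPad, hi]

lemma zeroPad_mem_stdSimplex (hkn : k ≤ n) {q : Fin k → ℝ} (hq : q ∈ stdSimplex ℝ (Fin k)) :
    zeroPad n q ∈ stdSimplex ℝ (Fin n) := by
  refine ⟨fun i => ?_, (sum_zeroPad hkn q).trans hq.2⟩
  unfold zeroPad
  split_ifs
  exacts [hq.1 _, le_rfl]

lemma piVec_pos (hk1 : 1 ≤ k) (hkn : k ≤ n) (hp : IsSortedPrior p) (l : Fin k) :
    0 < piVec p k hkn l := by
  unfold piVec
  split_ifs
  exacts [hp.pos _, level_pos hk1 hkn hp]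

lemma lt_of_mem_giants (hk1 : 1 ≤ k) (hkn : k ≤ n) (hp : IsSortedPrior p) {i : Fin n}
    (hi : i ∈ giants p k) : i.val < k := by
  have := (jStar_mem hk1 hkn hp).1
  have := mem_giants.1 hi
  omega

lemma sum_piVec (hk1 : 1 ≤ k) (hkn : k ≤ n) (hp : IsSortedPrior p) :
    ∑ l, piVec p k hkn l = 1 := by
  -- After subtracting the level only the giants contribute.
  have h1 : ∑ l, (piVec p k hkn l - level p k) = ∑ i ∈ giants p k, (p i - level p k) := by
    calc _ = ∑ l, (fun i => if i ∈ giants p k then p i - level p k else 0) (Fin.castLE hkn l) :=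
          Finset.sum_congr rfl fun l _ => by
            simp only [piVec, mem_giants, Fin.val_castLE]
            split_ifs <;> simp
      _ = _ := by
          rw [sum_castLE hkn fun i => if i ∈ giants p k then p i - level p k else 0]
          · simp
          · intro i hi
            exact if_neg fun h => by have := lt_of_mem_giants hk1 hkn hp h; omega
  rw [Finset.sum_sub_distrib, Finset.sum_sub_distrib, Finset.sum_const, Finset.sum_const,
    nsmul_eq_mul, nsmul_eq_mul, Finset.card_univ, Fintype.card_fin] at h1
  have h2 := sum_giants_add_tailSum (k := k) hp
  have h3 := level_mul_gap hk1 hkn hp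
  have h4 : ((giants p k).card : ℝ) + 1 = jStar p k := by
    exact_mod_cast card_giants hk1 hkn hp
  rw [← h4] at h3
  linarith

lemma piVec_mem_stdSimplex (hk1 : 1 ≤ k) (hkn : k ≤ n) (hp : IsSortedPrior p) :
    piVec p k hkn ∈ stdSimplex ℝ (Fin k) :=
  ⟨fun l => (piVec_pos hk1 hkn hp l).le, sum_piVec hk1 hkn hp⟩

end WaterLevel

/-! ### Moving a support onto the first `k` positions. -/

section Placement

variable {n k : ℕ}

/-- If `A` consists of some of the first `k` positions, then any `k`-element set can be moved onto the
first `k` positions by a permutation that fixes its elements that belong to `A`. -/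
lemma exists_perm_to_initial (hkn : k ≤ n) {A : Finset (Fin n)} (hA : ∀ i ∈ A, i.val < k)
    {S : Finset (Fin n)} (hS : S.card = k) :
    ∃ σ : Equiv.Perm (Fin n), (∀ i, (σ i).val < k ↔ i ∈ S) ∧ ∀ i ∈ S, i ∈ A → σ i = i := by
  set T : Finset (Fin n) := {i | i.val < k} with hT
  have hTc : Fintype.card S = T.card := by
    rw [Fintype.card_coe, hS, hT, Fin.card_filter_val_lt]
    omega
  -- The inclusion of `S ∩ A` into the first `k` positions extends to a bijection from `S`, and that
  -- to a permutation.
  obtain ⟨e, he⟩ := Finset.exists_equiv_extend_of_card_eq hTc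
    (s := Finset.univ.filter fun i : S => i.val ∈ A) (f := Subtype.val)
    (by
      intro i hi
      simp only [Finset.mem_image, Finset.mem_filter, Finset.mem_univ, true_and] at hi
      obtain ⟨a, ha, rfl⟩ := hi
      simpa [hT] using hA _ ha)
    Subtype.val_injective.injOn
  refine ⟨e.extendSubtype, fun i => ?_, fun i hi hiA => ?_⟩
  · by_cases hi : i ∈ S
    · have := e.extendSubtype_mem i hi
      simpa [hT, hi] using this
    · have := e.extendSubtype_not_mem i hi
      simpa [hT, hi] using this
  · rw [e.extendSubtype_apply_of_mem i hi]
    exact he ⟨i, hi⟩ (by simpa using hiA)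

end Placement

/-! ### Output probabilities and posteriors. -/

section Channels

variable {n : ℕ} {Y : Type u} {p : Fin n → ℝ} {W : Fin n → Y → ℝ}

lemma outProb_nonneg (hp : ∀ x, 0 ≤ p x) (hW : IsChannel W) (y : Y) : 0 ≤ outProb p W y :=
  Finset.sum_nonneg fun x _ => mul_nonneg (hp x) (hW.nonneg x y)

lemma hasSum_outProb_weighted (hW : IsChannel W) (c : Fin n → ℝ) :
    HasSum (fun y => ∑ x, c x * W x y) (∑ x, c x) := by
  simpa using hasSum_sum (s := Finset.univ) fun x _ => (hW.hasSum_one x).mul_left (c x)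

lemma hasSum_outProb (hp1 : ∑ x, p x = 1) (hW : IsChannel W) : HasSum (outProb p W) 1 := by
  have := hasSum_outProb_weighted hW p
  rwa [hp1] at this

lemma posterior_mem_stdSimplex (hp : ∀ x, 0 ≤ p x) (hW : IsChannel W) {y : Y}
    (hy : 0 < outProb p W y) : posterior p W y ∈ stdSimplex ℝ (Fin n) := by
  refine ⟨fun x => div_nonneg (mul_nonneg (hp x) (hW.nonneg x y)) hy.le, ?_⟩
  simp only [posterior, ← Finset.sum_div]
  exact div_self hy.ne'

end Channels

/-! ### The linear system and the channel built from it. -/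

section AlgorithmOutput

variable {n k : ℕ} {p : Fin n → ℝ} {v : Finset (Fin n) → ℝ}

lemma mem_superSets {S M : Finset (Fin n)} : M ∈ superSets k S ↔ S ⊆ M ∧ M.card = k := by
  simp [superSets]

/-- The hypersimplex point has entries at most `1` by the choice of `j*`, and sum `(j* - 1) + (k -
j* + 1) = k`. -/
lemma exists_solvesSystem (hk1 : 1 ≤ k) (hkn : k ≤ n) (hp : IsSortedPrior p) :
    ∃ v, SolvesSystem p k v := by
  have hl := level_pos hk1 hkn hp
  obtain ⟨v, hv0, hvk, hv1, hv⟩ := exists_weights_of_hypersimplex k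
    (fun i => if i ∈ giants p k then 1 else p i / level p k)
    (fun i => by
      split_ifs
      exacts [zero_le_one, div_nonneg (hp.pos i).le hl.le])
    (fun i => by
      split_ifs with h
      · exact le_rfl
      · rw [mem_giants, not_lt] at h
        exact (div_le_one hl).2 (le_level hk1 hkn hp h))
    (by
      have h4 : ((giants p k).card : ℝ) + 1 = jStar p k := by
        exact_mod_cast card_giants hk1 hkn hp
      have h5 : ∑ i with i ∉ giants p k, p i = tailSum p (jStar p k) := by
        simp [giants, tailSum]
      rw [Finset.sum_ite, Finset.sum_const, nsmul_one, ← Finset.sum_div, h5,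
        ← level_mul_gap hk1 hkn hp, mul_div_cancel_left₀ _ hl.ne', Finset.filter_univ_mem]
      linarith)
  -- A giant has coordinate `1`, the total weight, so sets that miss it carry none.
  have hzero : ∀ M, ¬ giants p k ⊆ M → v M = 0 := by
    intro M hM
    obtain ⟨a, ha, haM⟩ := Finset.not_subset.1 hM
    have h := hv a
    rw [if_pos ha, ← hv1, ← Finset.sum_filter_add_sum_filter_not Finset.univ (a ∈ ·)] at h
    have h' : ∑ M with a ∉ M, v M = 0 := by linarith
    exact (Finset.sum_eq_zero_iff_of_nonneg fun M _ => hv0 M).1 h' M (by simpa using haM)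
  refine ⟨fun M => level p k * v M, fun M _ => mul_nonneg hl.le (hv0 M), fun i hi => ?_⟩
  have hi' : i ∉ giants p k := by rw [mem_giants]; omega
  have h := hv i
  rw [if_neg hi', eq_div_iff hl.ne'] at h
  rw [← Finset.mul_sum, mul_comm, ← h]
  congr 1
  refine Finset.sum_subset (fun M hM => ?_) fun M hM hM' => ?_
  · simpa using (mem_superSets.1 hM).1 (Finset.mem_insert_self _ _)
  · by_cases hc : M.card = k
    · refine hzero M fun hs => hM' (mem_superSets.2 ⟨?_, hc⟩)
      exact Finset.insert_subset (by simpa using hM) hs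
    · exact hvk M hc

/-- Double counting: each `M` contains exactly `k - j* + 1` non-giants, so the equations add up to
that multiple of the total. This makes the giants' rows sum to one. -/
lemma sum_solution (hk1 : 1 ≤ k) (hkn : k ≤ n) (hp : IsSortedPrior p) (hv : SolvesSystem p k v) :
    ∑ M ∈ superSets k (giants p k), v M = level p k := by
  have hgap := gap_pos hk1 hkn hp
  rw [← mul_left_inj' hgap.ne', level_mul_gap hk1 hkn hp]
  have h4 : ((giants p k).card : ℝ) + 1 = jStar p k := by
    exact_mod_cast card_giants hk1 hkn hp
  have h5 : tailSum p (jStar p k) = ∑ i with i ∉ giants p k, p i := by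
    simp [giants, tailSum]
  have h6 : ∀ i ∉ giants p k,
      p i = ∑ M ∈ superSets k (giants p k), if i ∈ M then v M else 0 := by
    intro i hi
    rw [← hv.eq i (by rw [mem_giants] at hi; omega), ← Finset.sum_filter]
    refine Finset.sum_congr ?_ fun _ _ => rfl
    ext M
    simp only [mem_superSets, Finset.insert_subset_iff, Finset.mem_filter]
    tauto
  rw [h5, Finset.sum_congr rfl fun i hi => h6 i (by simpa using hi), Finset.sum_comm,
    Finset.sum_mul]
  refine Finset.sum_congr rfl fun M hM => ?_
  obtain ⟨hGM, hMk⟩ := mem_superSets.1 hM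
  rw [← Finset.sum_filter, Finset.sum_const, nsmul_eq_mul, mul_comm]
  congr 1
  have h7 : ((Finset.univ.filter (· ∉ giants p k)).filter (· ∈ M)) = M \ giants p k := by
    ext i
    simp [and_comm]
  have h8 : ((M \ giants p k).card : ℝ) + (giants p k).card = k := by
    exact_mod_cast (Finset.card_sdiff_add_card_eq_card hGM).trans hMk
  rw [h7]
  linarith

lemma algMatrix_isChannel (hk1 : 1 ≤ k) (hkn : k ≤ n) (hp : IsSortedPrior p)
    (hv : SolvesSystem p k v) : IsChannel (algMatrix p k v) := by
  have hgap := gap_pos hk1 hkn hp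
  have hl := level_pos hk1 hkn hp
  have hlg := level_mul_gap hk1 hkn hp
  have htail : 0 < tailSum p (jStar p k) := by rw [← hlg]; positivity
  have hsub : ∀ i, superSets k (insert i (giants p k)) ⊆ superSets k (giants p k) := fun i M hM =>
    mem_superSets.2 ⟨(Finset.subset_insert _ _).trans (mem_superSets.1 hM).1, (mem_superSets.1 hM).2⟩
  have hsum : ∀ (S : Finset (Fin n)) (f : Finset (Fin n) → ℝ),
      ∑ M : {M : Finset (Fin n) // M.card = k}, (if M.val ∈ superSets k S then f M.val else 0)
        = ∑ M ∈ superSets k S, f M := by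
    intro S f
    rw [← Finset.sum_subtype (Finset.univ.filter fun M : Finset (Fin n) => M.card = k)
      (by simp) (fun M => if M ∈ superSets k S then f M else 0), ← Finset.sum_filter]
    refine Finset.sum_congr ?_ fun _ _ => rfl
    ext M
    simp only [Finset.mem_filter, Finset.mem_univ, true_and, mem_superSets]
    tauto
  constructor
  · intro i M
    unfold algMatrix
    split_ifs with h1 h2 h2
    · exact div_nonneg (hv.nonneg _ (hsub i h2)) (hp.pos i).le
    · exact le_rfl
    · exact div_nonneg (mul_nonneg (hv.nonneg _ h2) hgap.le) htail.le
    · exact le_rfl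
  · intro i
    convert hasSum_fintype (algMatrix p k v i)
    unfold algMatrix
    split_ifs with h1
    · rw [hsum _ fun M => v M / p i, ← Finset.sum_div, hv.eq i h1, div_self (hp.pos i).ne']
    · rw [hsum _ fun M => v M * ((k : ℝ) - jStar p k + 1) / tailSum p (jStar p k),
        ← Finset.sum_div, ← Finset.sum_mul, sum_solution hk1 hkn hp hv, hlg, div_self htail.ne']

lemma algMatrix_preImCap : PreImCap k (algMatrix p k v) := by
  intro M
  have hsub : preIm (algMatrix p k v) M ⊆ (M.val : Set (Fin n)) := by
    intro i hi
    have hi' : 0 < algMatrix p k v i M := hi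
    unfold algMatrix at hi'
    split_ifs at hi' with h1 h2 h2
    · exact (mem_superSets.1 h2).1 (Finset.mem_insert_self _ _)
    · exact absurd hi' (lt_irrefl _)
    · exact (mem_superSets.1 h2).1 (mem_giants.2 (by omega))
    · exact absurd hi' (lt_irrefl _)
  calc _ ≤ (M.val : Set (Fin n)).ncard := Set.ncard_le_ncard hsub
    _ = k := by rw [Set.ncard_coe_finset, M.2]

/-- Every posterior distribution of an output of the algorithm is a rearrangement of `piVec`,
extended by zeros. -/
lemma exists_posterior_algMatrix_eq (hk1 : 1 ≤ k) (hkn : k ≤ n) (hp : IsSortedPrior p)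
    (M : {M : Finset (Fin n) // M.card = k}) (hM : outProb p (algMatrix p k v) M ≠ 0) :
    ∃ σ : Equiv.Perm (Fin n),
      posterior p (algMatrix p k v) M = zeroPad n (piVec p k hkn) ∘ σ := by
  have hgap := gap_pos hk1 hkn hp
  have hl := level_pos hk1 hkn hp
  have hlg := level_mul_gap hk1 hkn hp
  by_cases hGM : giants p k ⊆ M.val
  swap
  · refine absurd (Finset.sum_eq_zero fun i _ => ?_) hM
    have h1 : M.val ∉ superSets k (giants p k) := fun h => hGM (mem_superSets.1 h).1
    have h2 : M.val ∉ superSets k (insert i (giants p k)) := fun h =>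
      hGM ((Finset.subset_insert _ _).trans (mem_superSets.1 h).1)
    simp [algMatrix, h1, h2]
  obtain ⟨σ, hσ, hσG⟩ := exists_perm_to_initial hkn
    (fun i (hi : i ∈ giants p k) => lt_of_mem_giants hk1 hkn hp hi) M.2
  -- The joint probability is `v M / ℓ * p i` for a giant and `v M = v M / ℓ * ℓ` for any other
  -- element of `M`.
  have hval : ∀ i, p i * algMatrix p k v i M
      = v M.val / level p k * (zeroPad n (piVec p k hkn) ∘ σ) i := by
    intro i
    by_cases hiM : i ∈ M.val
    · have hσk := (hσ i).2 hiM
      by_cases hi : i ∈ giants p k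
      · have hi' := mem_giants.1 hi
        have hik := lt_of_mem_giants hk1 hkn hp hi
        have h1 : M.val ∈ superSets k (giants p k) := mem_superSets.2 ⟨hGM, M.2⟩
        simp only [algMatrix, if_neg (not_le.2 hi'), if_pos h1, Function.comp_apply,
          hσG i hiM hi, zeroPad, dif_pos hik, piVec, if_pos hi', ← hlg]
        rw [mul_div_mul_right _ _ hgap.ne']
        exact mul_comm _ _
      -- Giants all lie in `M` and are fixed by `σ`, so injectivity keeps other elements off their
      -- positions.
      · have hσi : σ i ∉ giants p k := fun h => hi (by
          rwa [σ.injective (hσG _ (hGM h) h)] at h)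
        have h1 : M.val ∈ superSets k (insert i (giants p k)) :=
          mem_superSets.2 ⟨Finset.insert_subset hiM hGM, M.2⟩
        rw [mem_giants] at hi hσi
        simp only [algMatrix, if_pos (not_lt.1 hi), if_pos h1, Function.comp_apply, zeroPad,
          dif_pos hσk, piVec, if_neg hσi]
        rw [mul_div_cancel₀ _ (hp.pos i).ne', div_mul_cancel₀ _ hl.ne']
    · have hσk : ¬ (σ i).val < k := fun h => hiM ((hσ i).1 h)
      have hi : ¬ i.val + 1 < jStar p k := fun h => hiM (hGM (mem_giants.2 h))
      have h1 : M.val ∉ superSets k (insert i (giants p k)) := fun h =>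
        hiM ((mem_superSets.1 h).1 (Finset.mem_insert_self _ _))
      simp [algMatrix, if_pos (not_lt.1 hi), h1, zeroPad, hσk]
  have hout : outProb p (algMatrix p k v) M = v M.val / level p k := by
    have := (comp_perm_mem_stdSimplex
      (zeroPad_mem_stdSimplex hkn (piVec_mem_stdSimplex hk1 hkn hp)) σ).2
    rw [outProb, Finset.sum_congr rfl fun i _ => hval i, ← Finset.mul_sum, this, mul_one]
  refine ⟨σ, funext fun i => ?_⟩
  rw [posterior, hval, hout, mul_div_cancel_left₀ _ (hout ▸ hM)]

end AlgorithmOutput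

/-! ### Bounds and change of length for symmetric, expansible functions. -/

section SymmetricConcave

/-- All vertices share one value, a lower bound by Jensen; at the uniform point the symmetrised
supergradient is constant, so its linear term vanishes on the simplex. No continuity is needed. -/
lemma exists_min_max_of_symmetric_concave {ι : Type*} [Fintype ι] [Nonempty ι] {f : (ι → ℝ) → ℝ}
    (hf : ConcaveOn ℝ (stdSimplex ℝ ι) f)
    (hsymm : ∀ q ∈ stdSimplex ℝ ι, ∀ σ : Equiv.Perm ι, f (q ∘ σ) = f q) :
    ∃ q₀ ∈ stdSimplex ℝ ι, ∃ q₁ ∈ stdSimplex ℝ ι, ∀ q ∈ stdSimplex ℝ ι, f q₀ ≤ f q ∧ f q ≤ f q₁ := by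
  classical
  have hcard : (0 : ℝ) < Fintype.card ι := by exact_mod_cast Fintype.card_pos
  have hunif : (fun _ => (Fintype.card ι : ℝ)⁻¹) ∈ stdSimplex ℝ ι :=
    ⟨fun _ => by positivity, by simp [hcard.ne']⟩
  obtain ⟨g, hg, hgt, -⟩ := exists_supergradient_of_symmetric hf hsymm hunif
    fun _ => by positivity
  obtain ⟨a⟩ := ‹Nonempty ι›
  refine ⟨Pi.single a 1, single_mem_stdSimplex ℝ a, _, hunif, fun q hq => ⟨?_, ?_⟩⟩
  · have hvert : ∀ i, f (Pi.single i 1) = f (Pi.single a 1) := fun i => by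
      rw [← hsymm _ (single_mem_stdSimplex ℝ a) (Equiv.swap i a)]
      congr 1
      ext j
      simp only [Function.comp_apply, Pi.single_apply]
      rw [Equiv.swap_apply_eq_iff, Equiv.swap_apply_right]
    have h := hf.le_map_sum (t := Finset.univ) (w := q) (p := fun i => Pi.single i 1)
      (fun i _ => hq.1 i) hq.2 fun i _ => single_mem_stdSimplex ℝ i
    have hsum : ∑ i, q i • (Pi.single i (1 : ℝ) : ι → ℝ) = q := by
      ext j
      simp [Finset.sum_apply, Pi.single_apply]
    rw [hsum] at h
    simpa only [hvert, smul_eq_mul, ← Finset.sum_mul, hq.2, one_mul] using h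
  · refine (hg q hq).trans_eq ?_
    rw [Finset.sum_congr rfl fun i _ => by rw [hgt i a rfl], ← Finset.mul_sum,
      Finset.sum_sub_distrib, hq.2, hunif.2]
    simp

lemma expansible_zeroPad {F : (m : ℕ) → (Fin m → ℝ) → ℝ}
    (hexp : ∀ (m : ℕ) (q : Fin m → ℝ), q ∈ stdSimplex ℝ (Fin m) →
      F (m + 1) (Fin.snoc (α := fun _ => ℝ) q 0) = F m q)
    {n k : ℕ} (hkn : k ≤ n) {q : Fin k → ℝ} (hq : q ∈ stdSimplex ℝ (Fin k)) :
    F n (zeroPad n q) = F k q := by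
  induction n, hkn using Nat.le_induction with
  | base =>
    congr 1
    ext i
    simp [zeroPad]
  | succ m hm ih =>
    rw [← ih, ← hexp m _ (zeroPad_mem_stdSimplex hm hq)]
    congr 1
    ext i
    refine Fin.lastCases ?_ (fun i => ?_) i
    · simp [zeroPad, hm]
    · simp [zeroPad]

lemma concaveOn_of_expansible {F : (m : ℕ) → (Fin m → ℝ) → ℝ}
    (hexp : ∀ (m : ℕ) (q : Fin m → ℝ), q ∈ stdSimplex ℝ (Fin m) →
      F (m + 1) (Fin.snoc (α := fun _ => ℝ) q 0) = F m q)
    {n k : ℕ} (hkn : k ≤ n) (hF : ConcaveOn ℝ (stdSimplex ℝ (Fin n)) (F n)) :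
    ConcaveOn ℝ (stdSimplex ℝ (Fin k)) (F k) := by
  refine ⟨convex_stdSimplex ℝ _, fun x hx y hy a b ha hb hab => ?_⟩
  have hxy := convex_stdSimplex ℝ (Fin k) hx hy ha hb hab
  rw [← expansible_zeroPad hexp hkn hx, ← expansible_zeroPad hexp hkn hy,
    ← expansible_zeroPad hexp hkn hxy]
  refine (hF.2 (zeroPad_mem_stdSimplex hkn hx) (zeroPad_mem_stdSimplex hkn hy) ha hb hab).trans_eq ?_
  congr 1
  ext i
  simp only [zeroPad, Pi.add_apply, Pi.smul_apply, smul_eq_mul]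
  split_ifs <;> simp

end SymmetricConcave

/-! ### The mean of `F` over the posteriors. -/

section PosteriorMean

variable {n k : ℕ} {Y : Type u} {p : Fin n → ℝ} {W : Fin n → Y → ℝ}

lemma summable_outProb_mul {f : (Fin n → ℝ) → ℝ} (hp : ∀ x, 0 ≤ p x) (hp1 : ∑ x, p x = 1)
    (hW : IsChannel W) {a b : ℝ} (hf : ∀ q ∈ stdSimplex ℝ (Fin n), a ≤ f q ∧ f q ≤ b) :
    Summable fun y => outProb p W y * f (posterior p W y) := by
  refine ((hasSum_outProb hp1 hW).summable.mul_right (max |a| |b|)).of_norm_bounded fun y => ?_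
  have h0 := outProb_nonneg hp hW y
  rw [Real.norm_eq_abs, abs_mul, abs_of_nonneg h0]
  rcases h0.eq_or_lt with h | h
  · simp [← h]
  · obtain ⟨h1, h2⟩ := hf _ (posterior_mem_stdSimplex hp hW h)
    exact mul_le_mul_of_nonneg_left (abs_le_max_abs_abs h1 h2) h0

lemma tsum_outProb_mul_mem_Icc {f : (Fin n → ℝ) → ℝ} (hp : ∀ x, 0 ≤ p x) (hp1 : ∑ x, p x = 1)
    (hW : IsChannel W) {a b : ℝ} (hf : ∀ q ∈ stdSimplex ℝ (Fin n), a ≤ f q ∧ f q ≤ b) :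
    ∑' y, outProb p W y * f (posterior p W y) ∈ Set.Icc a b := by
  have hs := summable_outProb_mul hp hp1 hW hf
  have ho := hasSum_outProb hp1 hW
  have key : ∀ y, outProb p W y * a ≤ outProb p W y * f (posterior p W y) ∧
      outProb p W y * f (posterior p W y) ≤ outProb p W y * b := fun y => by
    have h0 := outProb_nonneg hp hW y
    rcases h0.eq_or_lt with h | h
    · simp [← h]
    · obtain ⟨h1, h2⟩ := hf _ (posterior_mem_stdSimplex hp hW h)
      exact ⟨mul_le_mul_of_nonneg_left h1 h0, mul_le_mul_of_nonneg_left h2 h0⟩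
  constructor
  · simpa using hasSum_le (fun y => (key y).1) (ho.mul_right a) hs.hasSum
  · simpa using hasSum_le (fun y => (key y).2) hs.hasSum (ho.mul_right b)

/-- The upper bound: for a symmetric, expansible and concave `F`, the mean of `F` over the posterior
distributions of a feasible channel does not exceed the value of `F` at `piVec`. -/
lemma tsum_outProb_mul_le (hk1 : 1 ≤ k) (hkn : k ≤ n) (hp : IsSortedPrior p)
    {F : (m : ℕ) → (Fin m → ℝ) → ℝ}
    (hsymm : ∀ (m : ℕ) (q : Fin m → ℝ), q ∈ stdSimplex ℝ (Fin m) →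
      ∀ σ : Equiv.Perm (Fin m), F m (q ∘ σ) = F m q)
    (hexp : ∀ (m : ℕ) (q : Fin m → ℝ), q ∈ stdSimplex ℝ (Fin m) →
      F (m + 1) (Fin.snoc (α := fun _ => ℝ) q 0) = F m q)
    (hF : ConcaveOn ℝ (stdSimplex ℝ (Fin n)) (F n))
    (hW : IsChannel W) (hcap : PreImCap k W)
    (hs : Summable fun y => outProb p W y * F n (posterior p W y)) :
    ∑' y, outProb p W y * F n (posterior p W y) ≤ F k (piVec p k hkn) := by
  have hπ := piVec_mem_stdSimplex hk1 hkn hp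
  have hp0 : ∀ x, 0 ≤ p x := fun x => (hp.pos x).le
  obtain ⟨g, hg, hgt, hgm⟩ := exists_supergradient_of_symmetric
    (concaveOn_of_expansible hexp hkn hF) (hsymm k) hπ (piVec_pos hk1 hkn hp)
  -- The last position is on the plateau since `j* ≤ k`.
  set c := g ⟨k - 1, by omega⟩ with hc
  have hjk := (jStar_mem hk1 hkn hp).1
  have hlast : piVec p k hkn ⟨k - 1, by omega⟩ = level p k := if_neg (by simp only; omega)
  have hgc : ∀ l : Fin k, ¬ l.val + 1 < jStar p k → g l = c := fun l hl =>
    hgt _ _ (by rw [hlast]; exact if_neg hl)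
  have hgle : ∀ l : Fin k, g l ≤ c := fun l => by
    by_cases hl : l.val + 1 < jStar p k
    · refine hgm _ _ ?_
      rw [hlast, piVec, if_pos hl]
      exact level_lt hk1 hkn hp hl
    · exact (hgc l hl).le
  set G : Fin n → ℝ := fun i => if h : i.val < k then g ⟨i, h⟩ else c with hG
  have hGc : ∀ i, i ∉ giants p k → G i = c := fun i hi => by
    simp only [hG]
    split_ifs with h
    · exact hgc _ (by rwa [mem_giants] at hi)
    · rfl
  have hGle : ∀ i, G i ≤ c := fun i => by
    simp only [hG]
    split_ifs
    exacts [hgle _, le_rfl]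
  -- Both vectors have mass one, so `c` may be subtracted; what remains lives on the giants, where
  -- `p` and `π` agree.
  have hprior : ∑ i, p i * G i = ∑ l, g l * piVec p k hkn l := by
    have h1 : ∑ l, (g l - c) * piVec p k hkn l = ∑ i, p i * (G i - c) := by
      rw [← sum_castLE hkn]
      · refine Finset.sum_congr rfl fun l _ => ?_
        by_cases hl : l.val + 1 < jStar p k
        · simp [piVec, hl, hG, mul_comm]
        · rw [hgc l hl, hGc _ (by simpa [mem_giants] using hl)]
          simp
      · intro i hi
        simp [hG, not_lt.2 hi]
    simp only [sub_mul, mul_sub, Finset.sum_sub_distrib, ← Finset.sum_mul, ← Finset.mul_sum] at h1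
    rw [hπ.2, hp.sum_eq_one] at h1
    linarith
  have hterm : ∀ y, outProb p W y * F n (posterior p W y) ≤
      outProb p W y * (F k (piVec p k hkn) - ∑ l, g l * piVec p k hkn l)
        + ∑ x, p x * G x * W x y := by
    intro y
    rcases (outProb_nonneg hp0 hW y).eq_or_lt with h | h
    · have hzero : ∀ x, p x * W x y = 0 := fun x =>
        (Finset.sum_eq_zero_iff_of_nonneg fun x _ => mul_nonneg (hp0 x) (hW.nonneg x y)).1 h.symm x
          (Finset.mem_univ x)
      have hzero' : ∑ x, p x * G x * W x y = 0 := Finset.sum_eq_zero fun x _ => by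
        rw [mul_right_comm, hzero, zero_mul]
      simp [← h, hzero']
    have hq := posterior_mem_stdSimplex hp0 hW h
    set q := posterior p W y with hqdef
    -- Enlarge the pre-image to exactly `k` secrets; the added ones have posterior zero.
    obtain ⟨S, hSsub, hScard⟩ := Finset.exists_superset_card_eq
      (s := Finset.univ.filter fun x => 0 < W x y) (n := k)
      (by
        have := hcap y
        rwa [preIm, Set.ncard_eq_toFinset_card', Set.toFinset_ofPred] at this)
      (by simpa using hkn)
    have hqS : ∀ x, x ∉ S → q x = 0 := fun x hx => by
      have : W x y = 0 := le_antisymm (not_lt.1 fun h => hx (hSsub (by simpa using h)))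
        (hW.nonneg x y)
      simp [hqdef, posterior, this]
    obtain ⟨σ, hσ, hσG⟩ := exists_perm_to_initial hkn
      (fun i (hi : i ∈ giants p k) => lt_of_mem_giants hk1 hkn hp hi) hScard
    set r : Fin k → ℝ := fun l => q (σ.symm (Fin.castLE hkn l)) with hr
    have hpad : zeroPad n r = q ∘ σ.symm := by
      ext i
      simp only [zeroPad, Function.comp_apply]
      split_ifs with hi
      · rfl
      · exact (hqS _ fun hS => hi (by simpa using (hσ _).2 hS)).symm
    have hrS : r ∈ stdSimplex ℝ (Fin k) := by
      refine ⟨fun l => hq.1 _, ?_⟩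
      rw [← sum_zeroPad hkn, hpad]
      exact (comp_perm_mem_stdSimplex hq σ.symm).2
    have hFr : F n q = F k r := by
      rw [← expansible_zeroPad hexp hkn hrS, hpad, hsymm n q hq]
    -- Giants in `S` stay put; any other secret has weight `c`, at least the weight of its new
    -- position.
    have hgr : ∑ l, g l * r l ≤ ∑ x, q x * G x := by
      calc ∑ l, g l * r l = ∑ i, G i * zeroPad n r i := by
            rw [← sum_castLE hkn]
            · simp [hG, zeroPad]
            · intro i hi
              simp [zeroPad, hi]
        _ = ∑ x, G (σ x) * q x := by
            rw [← Equiv.sum_comp σ, hpad]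
            simp
        _ ≤ ∑ x, q x * G x := by
            refine Finset.sum_le_sum fun x _ => ?_
            rw [mul_comm]
            by_cases hx : x ∈ S
            · by_cases hxG : x ∈ giants p k
              · rw [hσG x hx hxG]
              · rw [hGc x hxG]
                exact mul_le_mul_of_nonneg_left (hGle _) (hq.1 x)
            · simp [hqS x hx]
    have hsup := hg r hrS
    simp only [mul_sub, Finset.sum_sub_distrib] at hsup
    have hout : ∑ x, p x * G x * W x y = outProb p W y * ∑ x, q x * G x := by
      rw [Finset.mul_sum]
      refine Finset.sum_congr rfl fun x _ => ?_
      rw [hqdef, posterior]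
      field_simp
    rw [hout, ← mul_add, hFr]
    exact mul_le_mul_of_nonneg_left (by linarith) h.le
  have hsum := ((hasSum_outProb hp.sum_eq_one hW).mul_right
    (F k (piVec p k hkn) - ∑ l, g l * piVec p k hkn l)).add
    (hasSum_outProb_weighted hW fun x => p x * G x)
  refine (hasSum_le hterm hs.hasSum hsum).trans_eq ?_
  rw [hprior]
  ring

/-- The outputs of the algorithm attain the value of `F` at `piVec`. -/
lemma tsum_outProb_mul_algMatrix (hk1 : 1 ≤ k) (hkn : k ≤ n) (hp : IsSortedPrior p)
    {F : (m : ℕ) → (Fin m → ℝ) → ℝ}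
    (hsymm : ∀ (m : ℕ) (q : Fin m → ℝ), q ∈ stdSimplex ℝ (Fin m) →
      ∀ σ : Equiv.Perm (Fin m), F m (q ∘ σ) = F m q)
    (hexp : ∀ (m : ℕ) (q : Fin m → ℝ), q ∈ stdSimplex ℝ (Fin m) →
      F (m + 1) (Fin.snoc (α := fun _ => ℝ) q 0) = F m q)
    {v : Finset (Fin n) → ℝ} (hv : SolvesSystem p k v) :
    ∑' M, outProb p (algMatrix p k v) M * F n (posterior p (algMatrix p k v) M)
      = F k (piVec p k hkn) := by
  have hπ := piVec_mem_stdSimplex hk1 hkn hp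
  have h : ∀ M, outProb p (algMatrix p k v) M * F n (posterior p (algMatrix p k v) M)
      = outProb p (algMatrix p k v) M * F k (piVec p k hkn) := by
    intro M
    by_cases hM : outProb p (algMatrix p k v) M = 0
    · simp [hM]
    obtain ⟨σ, hσ⟩ := exists_posterior_algMatrix_eq hk1 hkn hp M hM
    rw [hσ, hsymm n _ (zeroPad_mem_stdSimplex hkn hπ), expansible_zeroPad hexp hkn hπ]
  rw [tsum_congr h, tsum_mul_right,
    (hasSum_outProb hp.sum_eq_one (algMatrix_isChannel hk1 hkn hp hv)).tsum_eq, one_mul]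

lemma IsChannel.comp_equiv {Z : Type*} (hW : IsChannel W) (e : Z ≃ Y) :
    IsChannel fun x z => W x (e z) :=
  ⟨fun x z => hW.nonneg x (e z), fun x => (e.hasSum_iff (f := W x)).2 (hW.hasSum_one x)⟩

/-- Relabelling the observables of a channel does not change the posterior entropy. -/
lemma posteriorEntropy_comp_equiv {Z : Type*} (F : (m : ℕ) → (Fin m → ℝ) → ℝ) (η : ℝ → ℝ)
    (e : Z ≃ Y) : posteriorEntropy F η p (fun x z => W x (e z)) = posteriorEntropy F η p W :=
  congrArg η (e.tsum_eq fun y => outProb p W y * F n (posterior p W y))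

end PosteriorMean

/-! ### From `F` to the entropy. -/

section GenEntropy

variable {n k : ℕ} {F : (m : ℕ) → (Fin m → ℝ) → ℝ} {η : ℝ → ℝ}

lemma IsGenEntropy.exists_bounds (hn : 0 < n) (h : IsGenEntropy n F η) :
    ∃ q₀ ∈ stdSimplex ℝ (Fin n), ∃ q₁ ∈ stdSimplex ℝ (Fin n), ∀ q ∈ stdSimplex ℝ (Fin n),
      F n q₀ ≤ F n q ∧ F n q ≤ F n q₁ := by
  have : Nonempty (Fin n) := ⟨⟨0, hn⟩⟩
  rcases h.core_concave with ⟨-, hF⟩ | ⟨-, hF⟩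
  · exact exists_min_max_of_symmetric_concave hF (h.symmetric n)
  · obtain ⟨q₀, hq₀, q₁, hq₁, hb⟩ := exists_min_max_of_symmetric_concave hF.neg
      fun q hq σ => congrArg Neg.neg (h.symmetric n q hq σ)
    exact ⟨q₁, hq₁, q₀, hq₀, fun q hq =>
      ⟨neg_le_neg_iff.1 (hb q hq).2, neg_le_neg_iff.1 (hb q hq).1⟩⟩

lemma IsGenEntropy.summable (hn : 0 < n) (h : IsGenEntropy n F η) {Y : Type u} {p : Fin n → ℝ}
    (hp : IsSortedPrior p) {W : Fin n → Y → ℝ} (hW : IsChannel W) :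
    Summable fun y => outProb p W y * F n (posterior p W y) := by
  obtain ⟨q₀, -, q₁, -, hb⟩ := h.exists_bounds hn
  exact summable_outProb_mul (fun x => (hp.pos x).le) hp.sum_eq_one hW hb

lemma IsGenEntropy.posteriorEntropy_le (hk1 : 1 ≤ k) (hkn : k ≤ n) (h : IsGenEntropy n F η)
    {Y : Type u} {p : Fin n → ℝ} (hp : IsSortedPrior p) {W : Fin n → Y → ℝ} (hW : IsChannel W)
    (hcap : PreImCap k W) : posteriorEntropy F η p W ≤ entropy F η (piVec p k hkn) := by
  have hn : 0 < n := by omega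
  have hs := h.summable hn hp hW
  obtain ⟨q₀, hq₀, q₁, hq₁, hb⟩ := h.exists_bounds hn
  -- Monotonicity of `η` is known only on this hull, so the mean must be shown to lie between two
  -- values of `F`.
  have hmem := (convex_convexHull ℝ (F n '' stdSimplex ℝ (Fin n))).ordConnected.out
    (subset_convexHull ℝ _ ⟨q₀, hq₀, rfl⟩) (subset_convexHull ℝ _ ⟨q₁, hq₁, rfl⟩)
    (tsum_outProb_mul_mem_Icc (fun x => (hp.pos x).le) hp.sum_eq_one hW hb)
  have hπ := piVec_mem_stdSimplex hk1 hkn hp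
  have hmem' : F k (piVec p k hkn) ∈ convexHull ℝ (F n '' stdSimplex ℝ (Fin n)) :=
    subset_convexHull ℝ _ ⟨_, zeroPad_mem_stdSimplex hkn hπ, expansible_zeroPad h.expansible hkn hπ⟩
  rcases h.core_concave with ⟨hη, hF⟩ | ⟨hη, hF⟩
  · exact hη hmem hmem' (tsum_outProb_mul_le hk1 hkn hp h.symmetric h.expansible hF hW hcap hs)
  · refine hη hmem' hmem ?_
    have := tsum_outProb_mul_le (F := fun m q => -F m q) hk1 hkn hp
      (fun m q hq σ => congrArg Neg.neg (h.symmetric m q hq σ))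
      (fun m q hq => congrArg Neg.neg (h.expansible m q hq)) hF.neg hW hcap
      (by simpa only [mul_neg] using hs.neg)
    simp only [mul_neg, tsum_neg] at this
    exact neg_le_neg_iff.1 this

end GenEntropy

end OptimalChannel

/-- For a sorted prior `p` on `n` secrets and a pre-image cap `k`: for every generalised entropy the
maximum posterior entropy over all channels whose pre-images have size at most `k` is `H(π)`, and
every output of the algorithm (there is one) is such a channel and attains `H(π)` for all
generalised entropies at once. -/
theorem theorem1 (n k : ℕ) (hk1 : 1 ≤ k) (hkn : k ≤ n) (p : Fin n → ℝ)
    (hp : OptimalChannel.IsSortedPrior p) :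
    OptimalChannel.piVec p k hkn ∈ stdSimplex ℝ (Fin k) ∧
    (∀ (F : (m : ℕ) → (Fin m → ℝ) → ℝ) (η : ℝ → ℝ), OptimalChannel.IsGenEntropy n F η →
      (∀ (Y : Type u) (W : Fin n → Y → ℝ), OptimalChannel.IsChannel W →
        Summable fun y =>
          OptimalChannel.outProb p W y * F n (OptimalChannel.posterior p W y)) ∧
      IsGreatest
        {h : ℝ | ∃ (Y : Type u) (W : Fin n → Y → ℝ),
          OptimalChannel.IsChannel W ∧ OptimalChannel.PreImCap k W ∧
            h = OptimalChannel.posteriorEntropy F η p W}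
        (OptimalChannel.entropy F η (OptimalChannel.piVec p k hkn))) ∧
    (∃ W, OptimalChannel.IsAlgOutput p k W) ∧
    (∀ W, OptimalChannel.IsAlgOutput p k W →
      OptimalChannel.IsChannel W ∧ OptimalChannel.PreImCap k W ∧
      ∀ (F : (m : ℕ) → (Fin m → ℝ) → ℝ) (η : ℝ → ℝ), OptimalChannel.IsGenEntropy n F η →
        OptimalChannel.posteriorEntropy F η p W =
          OptimalChannel.entropy F η (OptimalChannel.piVec p k hkn)) := by
  have hattain : ∀ v, OptimalChannel.SolvesSystem p k v →
      ∀ (F : (m : ℕ) → (Fin m → ℝ) → ℝ) (η : ℝ → ℝ), OptimalChannel.IsGenEntropy n F η →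
        OptimalChannel.posteriorEntropy F η p (OptimalChannel.algMatrix p k v) =
          OptimalChannel.entropy F η (OptimalChannel.piVec p k hkn) :=
    fun v hv F η h => congrArg η
      (OptimalChannel.tsum_outProb_mul_algMatrix hk1 hkn hp h.symmetric h.expansible hv)
  obtain ⟨v, hv⟩ := OptimalChannel.exists_solvesSystem hk1 hkn hp
  refine ⟨OptimalChannel.piVec_mem_stdSimplex hk1 hkn hp, fun F η h =>
    ⟨fun Y W hW => h.summable (by omega) hp hW, ?_, ?_⟩, ⟨_, v, hv, rfl⟩, ?_⟩
  · have hW := OptimalChannel.algMatrix_isChannel hk1 hkn hp hv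
    have hcap : OptimalChannel.PreImCap k (OptimalChannel.algMatrix p k v) :=
      OptimalChannel.algMatrix_preImCap
    -- The alphabet of `k`-element sets is lifted to the universe of the competing alphabets.
    refine ⟨ULift.{u} {M : Finset (Fin n) // M.card = k},
      fun x M => OptimalChannel.algMatrix p k v x (Equiv.ulift M),
      hW.comp_equiv Equiv.ulift, fun M => hcap M.down, ?_⟩
    rw [← hattain v hv F η h]
    exact (OptimalChannel.posteriorEntropy_comp_equiv F η Equiv.ulift).symm
  · rintro _ ⟨Y, W, hW, hcap, rfl⟩
    exact h.posteriorEntropy_le hk1 hkn hp hW hcap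
  · rintro _ ⟨w, hw, rfl⟩
    exact ⟨OptimalChannel.algMatrix_isChannel hk1 hkn hp hw, OptimalChannel.algMatrix_preImCap,
      hattain w hw⟩
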